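/- Let $\mathfrak b$ and $\mathfrak d$ be the bounding and the dominating number: the least cardinality of a $\le^*$-unbounded, respectively of a dominating, family of (strictly increasing) functions $\mathbb N\to\mathbb N$. A \emph{filter} here is a proper filter $F$ on $\mathbb N$ that contains all cofinite sets (so that all its members are infinite); it is \emph{nonmeager} if, as a subset of the Cantor space $P(\mathbb N)=\{0,1\}^{\mathbb N}$, it is not meager. A topological space $X$ is \emph{$F$-Menger} if for every sequence $\mathcal U_1,\mathcal U_2,\dots$ of open covers of $X$ there are finite $\mathcal V_n\subseteq\mathcal U_n$ such that $\{n : x\in\bigcup\mathcal V_n\}\in F$ for all $x\in X$; it is \emph{Hurewicz} if the same holds for the filter of cofinite sets, and \emph{Menger} if one can choose the finite sets $\mathcal V_n\subseteq\mathcal U_n$ so that $\bigcup_n\mathcal V_n$ covers $X$. For a property $\mathsf P$ of topological spaces, a set $X\subseteq\mathbb R$ is \emph{productively $\mathsf P$ in the realm of hereditarily Lindelöf spaces} if $X\times Y$ has $\mathsf P$ for every hereditarily Lindelöf space $Y$ with the property $\mathsf P$. Theorem. Assume that $\mathfrak b=\mathfrak d$, and let $F$ be a nonmeager filter. (1) There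 is a set $X\subseteq\mathbb R$ that, in the realm of hereditarily Lindelöf spaces, is productively $F$-Menger but not productively Menger, and that is not Hurewicz. (2) The property $F$-Menger is strictly between Hurewicz and Menger: every Hurewicz topological space is $F$-Menger, every $F$-Menger topological space is Menger, there is a set of real numbers that is $F$-Menger but not Hurewicz, and there is a set of real numbers that is Menger but not $F$-Menger. -/

import Mathlib

open Set Filter
open scoped Cardinal

universe u v

/-- The infinite subsets of `ℕ`, each identified with its increasing enumeration. -/
def infSets : Set (ℕ → ℕ) := {f | StrictMono f}

/-- `X` is `≤*`-bounded: some `b ∈ infSets` satisfies `x n ≤ b n` for all but finitely many `n`,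
for every `x ∈ X`. -/
def IsStarBounded (X : Set (ℕ → ℕ)) : Prop :=
  ∃ b ∈ infSets, ∀ x ∈ X, ∀ᶠ n in atTop, x n ≤ b n

/-- `X` is dominating: every `a ∈ infSets` is `≤*` some member of `X`. -/
def IsDominating (X : Set (ℕ → ℕ)) : Prop :=
  ∀ a ∈ infSets, ∃ x ∈ X, ∀ᶠ n in atTop, a n ≤ x n

/-- The bounding number `𝔟`. -/
noncomputable def boundingNumber : Cardinal.{0} :=
  sInf {c | ∃ X : Set (ℕ → ℕ), X ⊆ infSets ∧ ¬ IsStarBounded X ∧ #X = c}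

/-- The dominating number `𝔡`. -/
noncomputable def dominatingNumber : Cardinal.{0} :=
  sInf {c | ∃ X : Set (ℕ → ℕ), X ⊆ infSets ∧ IsDominating X ∧ #X = c}

/-- A filter on `ℕ` as a set of points of the Cantor space `ℕ → Bool` (product topology), each
subset of `ℕ` being identified with its characteristic function. -/
def filterAsCantorSubset (F : Filter ℕ) : Set (ℕ → Bool) := {x | {n | x n = true} ∈ F}

/-- A family of sets is an open cover of the space `X`. -/
def IsOpenCoverFamily (X : Type u) [TopologicalSpace X] (U : Set (Set X)) : Prop :=
  (∀ V ∈ U, IsOpen V) ∧ ⋃₀ U = univ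

/-- Menger's property. -/
def IsMenger (X : Type u) [TopologicalSpace X] : Prop :=
  ∀ U : ℕ → Set (Set X), (∀ n, IsOpenCoverFamily X (U n)) →
    ∃ V : ℕ → Set (Set X), (∀ n, V n ⊆ U n ∧ (V n).Finite) ∧ ⋃₀ (⋃ n, V n) = univ

/-- The property `F`-Menger: for every sequence of open covers there are finite subfamilies `V n`
of them with `{n | x ∈ ⋃₀ V n} ∈ F` for every point `x`. -/
def IsFilterMenger (F : Filter ℕ) (X : Type u) [TopologicalSpace X] : Prop :=
  ∀ U : ℕ → Set (Set X), (∀ n, IsOpenCoverFamily X (U n)) →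
    ∃ V : ℕ → Set (Set X), (∀ n, V n ⊆ U n ∧ (V n).Finite) ∧ ∀ x, {n | x ∈ ⋃₀ V n} ∈ F

/-- Hurewicz's property: every point belongs to `⋃₀ V n` for all but finitely many `n`. -/
def IsHurewicz (X : Type u) [TopologicalSpace X] : Prop :=
  ∀ U : ℕ → Set (Set X), (∀ n, IsOpenCoverFamily X (U n)) →
    ∃ V : ℕ → Set (Set X), (∀ n, V n ⊆ U n ∧ (V n).Finite) ∧ ∀ x, {n | x ∉ ⋃₀ V n}.Finite

/-- The set of reals `X` is productively `P` in the realm of hereditarily Lindelöf spaces: `X × Y`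
has the property `P` for every hereditarily Lindelöf space `Y` with the property `P`. -/
def IsProductivelyHL (P : ∀ (Z : Type u) [TopologicalSpace Z], Prop) (X : Set ℝ) : Prop :=
  ∀ (Y : Type u) [TopologicalSpace Y] [HereditarilyLindelofSpace Y], P Y → P (X × Y)

/-! ### Bounding and dominating families -/

/-! When `𝔟 = 𝔡` there is a scale `b i`: each function is eventually below all but fewer than `𝔟` of
the `b i` (`exists_scale`). Nonmeagerness of `F` yields for each `i` a set `x i`
(`exists_long_gaps_long_intervals`) such that `[n, b i n)` misses `x i` for `F`-many `n`, is
contained in it for infinitely many `n`, and never shows the pattern in, out, in.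

Let `A` be the `x i` together with the finite sets, and `B` the `x i` together with the cofinite
sets. The added sets absorb all but fewer than `𝔟` points, and the definition of `𝔟` handles the
rest; the gaps thus make `A` productively `F`-Menger, and the long runs make `B` Menger. The same
runs keep `A` from being Hurewicz. The diagonal of `A × B` is a closed copy of `{x i}`, where the
missing pattern refutes Menger. If `B` were `F`-Menger, `A × B` would be Menger; so `B` separates
Menger from `F`-Menger. -/

theorem exists_strictMono_ge (f : ℕ → ℕ) : ∃ g : ℕ → ℕ, StrictMono g ∧ ∀ n, f n ≤ g n := by
  refine ⟨fun n => ∑ k ∈ Finset.range (n + 1), (f k + 1), strictMono_nat_of_lt_succ fun n => ?_,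
    fun n => ?_⟩
  · rw [Finset.sum_range_succ _ (n + 1)]
    omega
  · simp only [Finset.sum_range_succ]
    omega

/-- Fewer than `𝔟` functions have a common `≤*`-bound. -/
theorem exists_eventually_ge_of_lt_boundingNumber {ι : Type} (h : #ι < boundingNumber)
    (f : ι → ℕ → ℕ) : ∃ b : ℕ → ℕ, StrictMono b ∧ ∀ i, ∀ᶠ n in atTop, f i n ≤ b n := by
  choose g hg hfg using fun i => exists_strictMono_ge (f i)
  have hb : IsStarBounded (range g) := by
    by_contra hb
    have : boundingNumber ≤ #(range g) :=
      csInf_le' ⟨range g, by rintro _ ⟨i, rfl⟩; exact hg i, hb, rfl⟩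
    exact (this.trans Cardinal.mk_range_le).not_gt h
  obtain ⟨b, hb, hgb⟩ := hb
  exact ⟨b, hb, fun i => (hgb _ (mem_range_self i)).mono fun n hn => (hfg i n).trans hn⟩

theorem exists_isDominating_mk_eq :
    ∃ X : Set (ℕ → ℕ), X ⊆ infSets ∧ IsDominating X ∧ #X = dominatingNumber :=
  csInf_mem (s := {c | ∃ X : Set (ℕ → ℕ), X ⊆ infSets ∧ IsDominating X ∧ #X = c})
    ⟨_, infSets, subset_rfl, fun a ha => ⟨a, ha, Eventually.of_forall fun _ => le_rfl⟩, rfl⟩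

/-- If `𝔟 = 𝔡`, then there is a scale. -/
theorem exists_scale (hbd : boundingNumber = dominatingNumber) :
    ∃ (ι : Type) (b : ι → ℕ → ℕ), (∀ i, StrictMono (b i)) ∧ (∀ i n, n < b i n) ∧
      (∀ g : ℕ → ℕ, #{i // ¬ ∀ᶠ n in atTop, g n ≤ b i n} < boundingNumber) ∧
      ∀ g : ℕ → ℕ, ∃ i, ∀ᶠ n in atTop, g n ≤ b i n := by
  obtain ⟨D, hD, hdom, hcard⟩ := exists_isDominating_mk_eq
  obtain ⟨r, hwo, hr⟩ := Cardinal.exists_ord_eq D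
  have hlt (d : D) : #{e // r e d} < boundingNumber := by
    have := Cardinal.card_typein_lt (r := r) d hr
    rwa [hbd, ← hcard]
  choose b hb hbge using fun d : D =>
    exists_eventually_ge_of_lt_boundingNumber (hlt d) (fun e n => e.1.1 n)
  have key (g : ℕ → ℕ) : ∃ d : D, ∀ᶠ n in atTop, g n ≤ d.1 n := by
    obtain ⟨g', hg', hgg'⟩ := exists_strictMono_ge g
    obtain ⟨d, hd, h⟩ := hdom g' hg'
    exact ⟨⟨d, hd⟩, h.mono fun n hn => (hgg' n).trans hn⟩
  -- `b d` dominates the predecessors of `d`, `d.1` keeps the family dominating, and `+ 1` forces `n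
  -- < b n`.
  refine ⟨D, fun d n => b d n + d.1 n + 1, fun d m n hmn => ?_, fun d n => ?_, fun g => ?_,
    fun g => ?_⟩
  · have h1 := hb d hmn
    have h2 : d.1 m < d.1 n := hD d.2 hmn
    simp only
    omega
  · have := (hb d).le_apply (x := n)
    simp only
    omega
  · obtain ⟨d, hd⟩ := key g
    refine (Cardinal.mk_subtype_le_of_subset fun e he => ?_).trans_lt (hlt d)
    by_contra hed
    apply he
    rcases trichotomous_of r e d with h | rfl | h
    · exact absurd h hed
    · exact hd.mono fun n hn => by simp only; omega
    · filter_upwards [hd, hbge e ⟨d, h⟩] with n h1 h2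
      omega
  · obtain ⟨d, hd⟩ := key g
    exact ⟨d, hd.mono fun n hn => by simp only; omega⟩

/-- Fewer than `𝔟` sequences of finite selections from countable sets are eventually contained in
a single one. -/
theorem exists_finite_eventually_subset {ι : Type} {α : Type*} (h : #ι < boundingNumber)
    {U : ℕ → Set α} (hU : ∀ n, (U n).Countable) {V : ι → ℕ → Set α}
    (hV : ∀ i n, V i n ⊆ U n ∧ (V i n).Finite) :
    ∃ W : ℕ → Set α, (∀ n, W n ⊆ U n ∧ (W n).Finite) ∧ ∀ i, ∀ᶠ n in atTop, V i n ⊆ W n := by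
  choose e he using fun n => (countable_iff_exists_injOn.1 (hU n))
  have hfin (n m : ℕ) : {a ∈ U n | e n a ≤ m}.Finite :=
    Set.Finite.of_finite_image ((finite_Iic m).subset (by rintro _ ⟨a, ha, rfl⟩; exact ha.2))
      ((he n).mono (sep_subset _ _))
  have hbd (i : ι) (n : ℕ) : ∃ m, ∀ a ∈ V i n, e n a ≤ m := by
    obtain ⟨m, hm⟩ := ((hV i n).2.image (e n)).bddAbove
    exact ⟨m, fun a ha => hm (mem_image_of_mem _ ha)⟩
  choose f hf using hbd
  obtain ⟨b, -, hb⟩ := exists_eventually_ge_of_lt_boundingNumber h f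
  exact ⟨fun n => {a ∈ U n | e n a ≤ b n}, fun n => ⟨sep_subset _ _, hfin n _⟩, fun i =>
    (hb i).mono fun n hn a ha => ⟨(hV i n).1 ha, (hf i n a ha).trans hn⟩⟩

/-! ### Nonmeager filters -/

theorem isMeagre_setOf_eventually_exists_true {c : ℕ → ℕ} (hc : StrictMono c) :
    IsMeagre {x : ℕ → Bool | ∀ᶠ j in atTop, ∃ k, c j ≤ k ∧ k < c (j + 1) ∧ x k = true} := by
  have : {x : ℕ → Bool | ∀ᶠ j in atTop, ∃ k, c j ≤ k ∧ k < c (j + 1) ∧ x k = true} =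
      ⋃ N, {x | ∀ j, N ≤ j → ∃ k ∈ Finset.Ico (c j) (c (j + 1)), x k = true} := by
    ext x
    simp [eventually_atTop, and_assoc]
  rw [this]
  refine isMeagre_iUnion fun N => IsNowhereDense.isMeagre ?_
  have hcl : IsClosed {x : ℕ → Bool | ∀ j, N ≤ j →
      ∃ k ∈ Finset.Ico (c j) (c (j + 1)), x k = true} := by
    simp only [ofPred_forall]
    refine isClosed_iInter fun j => isClosed_iInter fun _ => ?_
    have : {x : ℕ → Bool | ∃ k ∈ Finset.Ico (c j) (c (j + 1)), x k = true} =
        ⋃ k ∈ Finset.Ico (c j) (c (j + 1)), {x | x k = true} := by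
      ext x
      simp
    rw [this]
    exact isClosed_biUnion_finset fun k _ => isClosed_eq (continuous_apply k) continuous_const
  rw [IsNowhereDense, hcl.closure_eq, eq_empty_iff_forall_notMem]
  intro x hx
  obtain ⟨I, u, hu, hsub⟩ := isOpen_pi_iff.1 isOpen_interior x hx
  obtain ⟨M, hM⟩ := I.bddAbove
  -- A basic neighbourhood restricts only coordinates up to `M`, so zeroing the rest stays inside it
  -- but violates the condition on later intervals.
  let y : ℕ → Bool := fun k => if k ≤ M then x k else false
  have hy := interior_subset (hsub (show y ∈ (I : Set ℕ).pi u from fun k hk => by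
    simpa [y, hM hk] using (hu k hk).2))
  obtain ⟨k, hk, hyk⟩ := hy (N + M + 1) (by omega)
  have h1 := hc.le_apply (x := N + M + 1)
  have h2 := (Finset.mem_Ico.1 hk).1
  have : ¬ k ≤ M := by omega
  simp [y, this] at hyk

/-- A nonmeager filter has a member that misses infinitely many intervals of a given partition. -/
theorem exists_mem_frequently_disjoint {F : Filter ℕ}
    (hF : ¬ IsMeagre (filterAsCantorSubset F)) {c : ℕ → ℕ} (hc : StrictMono c) :
    ∃ A ∈ F, ∃ᶠ j in atTop, ∀ k, c j ≤ k → k < c (j + 1) → k ∉ A := by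
  by_contra! h
  refine hF ((isMeagre_setOf_eventually_exists_true hc).mono fun x hx => ?_)
  exact h _ hx

/-! ### Sparse sets with long intervals -/

theorem exists_long_gaps_long_intervals {F : Filter ℕ} (hfree : F ≤ cofinite)
    (hF : ¬ IsMeagre (filterAsCantorSubset F)) {b : ℕ → ℕ} (hb : StrictMono b)
    (hlt : ∀ n, n < b n) :
    ∃ x : ℕ → Bool,
      (∀ m : ℕ → ℕ, (∀ᶠ n in atTop, m n ≤ b n) →
        {n | ∀ k, n ≤ k → k < m n → x k = false} ∈ F) ∧
      (∃ᶠ n in atTop, ∀ k, n ≤ k → k < b n → x k = true) ∧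
      ∀ n i j k, n ≤ i → i < j → j < k → k < b n → x i = true → x j = false → x k = false := by
  classical
  let c : ℕ → ℕ := fun k => b^[k] 0
  have hcs (k : ℕ) : c (k + 1) = b (c k) := Function.iterate_succ_apply' b k 0
  have hc : StrictMono c := strictMono_nat_of_lt_succ fun k => by rw [hcs]; exact hlt _
  have hc2 : StrictMono fun j => c (2 * j) := fun i j hij => hc (by omega)
  obtain ⟨A, hA, hJ⟩ := exists_mem_frequently_disjoint hF hc2
  let J : Set ℕ := {j | ∀ k, c (2 * j) ≤ k → k < c (2 * (j + 1)) → k ∉ A}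
  -- Only the second half of each missed interval is filled. A window `[n, b n)` meeting it must
  -- start at or after `c (2 * j)`, hence in an interval that `A` misses.
  let x : ℕ → Bool := fun k => decide (∃ j ∈ J, c (2 * j + 1) ≤ k ∧ k < c (2 * j + 2))
  have hx (k : ℕ) : x k = true ↔ ∃ j ∈ J, c (2 * j + 1) ≤ k ∧ k < c (2 * j + 2) :=
    decide_eq_true_iff
  refine ⟨x, fun m hm => ?_, ?_, ?_⟩
  · rw [← Nat.cofinite_eq_atTop] at hm
    filter_upwards [hA, hfree hm] with n hn hmn k hnk hkm
    by_contra hk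
    obtain ⟨j, hj, hjk, hkj⟩ := (hx k).1 (by simpa using hk)
    rcases lt_or_ge n (c (2 * j)) with h | h
    · have := hb.monotone h.le
      rw [← hcs] at this
      omega
    · exact hj n h (by simpa [mul_add] using hnk.trans_lt hkj) hn
  · rw [frequently_atTop] at hJ ⊢
    intro N
    obtain ⟨j, hNj, hj⟩ := hJ N
    have := hc.le_apply (x := 2 * j + 1)
    refine ⟨c (2 * j + 1), by omega, fun k h1 h2 => (hx k).2 ⟨j, hj, h1, ?_⟩⟩
    rwa [← hcs] at h2
  · intro n i j k hni hij hjk hkb hi hj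
    by_contra hk
    obtain ⟨s, hs, h1, h2⟩ := (hx i).1 hi
    obtain ⟨t, ht, h3, h4⟩ := (hx k).1 (by simpa using hk)
    have hst : s < t := by
      rcases lt_trichotomy s t with h | rfl | h
      · exact h
      · have := (hx j).2 ⟨s, hs, by omega, by omega⟩
        simp [hj] at this
      · have := hc.monotone (show 2 * t + 2 ≤ 2 * s + 1 by omega)
        omega
    -- Since `n < c (2 * s + 2)`, the window ends before `c (2 * s + 3)`, hence before the next run.
    have h5 := hc.monotone (show 2 * s + 2 + 1 ≤ 2 * t + 1 by omega)
    have h6 := hb (hni.trans_lt h2)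
    rw [hcs (2 * s + 2)] at h5
    omega

/-! ### Selection properties -/

/-- The covering property common to Menger, Hurewicz and `F`-Menger: finite subfamilies `V n` of
given open covers can be chosen so that `{n | x ∈ ⋃₀ V n} ∈ S` for all points `x`. -/
def HasFiniteSelections (S : Set (Set ℕ)) (X : Type u) [TopologicalSpace X] : Prop :=
  ∀ U : ℕ → Set (Set X), (∀ n, IsOpenCoverFamily X (U n)) →
    ∃ V : ℕ → Set (Set X), (∀ n, V n ⊆ U n ∧ (V n).Finite) ∧ ∀ x, {n | x ∈ ⋃₀ V n} ∈ S

theorem isFilterMenger_iff {F : Filter ℕ} {X : Type u} [TopologicalSpace X] :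
    IsFilterMenger F X ↔ HasFiniteSelections F.sets X := Iff.rfl

theorem isHurewicz_iff {X : Type u} [TopologicalSpace X] :
    IsHurewicz X ↔ HasFiniteSelections (cofinite : Filter ℕ).sets X := Iff.rfl

theorem isMenger_iff {X : Type u} [TopologicalSpace X] :
    IsMenger X ↔ HasFiniteSelections {A | A.Nonempty} X := by
  have (V : ℕ → Set (Set X)) : ⋃₀ (⋃ n, V n) = univ ↔ ∀ x, {n | x ∈ ⋃₀ V n}.Nonempty := by
    simp only [eq_univ_iff_forall, sUnion_iUnion, mem_iUnion]
    rfl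
  simp only [IsMenger, this]
  rfl

theorem HasFiniteSelections.mono {S T : Set (Set ℕ)} (hST : S ⊆ T) {X : Type u}
    [TopologicalSpace X] (h : HasFiniteSelections S X) : HasFiniteSelections T X := fun U hU =>
  let ⟨V, hV, h⟩ := h U hU
  ⟨V, hV, fun x => hST (h x)⟩

theorem HasFiniteSelections.exists_of_continuous {S : Set (Set ℕ)} {X : Type u} {Y : Type v}
    [TopologicalSpace X] [TopologicalSpace Y] (h : HasFiniteSelections S X) {f : X → Y}
    (hf : Continuous f) {U : ℕ → Set (Set Y)} (hU : ∀ n, IsOpenCoverFamily Y (U n)) :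
    ∃ V : ℕ → Set (Set Y), (∀ n, V n ⊆ U n ∧ (V n).Finite) ∧
      ∀ x, {n | f x ∈ ⋃₀ V n} ∈ S := by
  obtain ⟨V, hV, hVS⟩ := h (fun n => preimage f '' U n) fun n => by
    refine ⟨?_, ?_⟩
    · rintro _ ⟨W, hW, rfl⟩
      exact ((hU n).1 W hW).preimage hf
    · rw [sUnion_image, ← preimage_iUnion₂, ← sUnion_eq_biUnion, (hU n).2, preimage_univ]
  have (n : ℕ) : ∃ T ⊆ U n, T.Finite ∧ preimage f '' T = V n :=
    exists_subset_image_finite_and.1 ⟨V n, (hV n).1, (hV n).2, rfl⟩ |>.elim fun T hT =>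
      ⟨T, hT.1, hT.2.1, hT.2.2.symm⟩
  choose T hTU hTf hT using this
  refine ⟨T, fun n => ⟨hTU n, hTf n⟩, fun x => ?_⟩
  convert hVS x using 4 with n
  rw [← hT n, sUnion_image, sUnion_eq_biUnion]
  simp

theorem HasFiniteSelections.of_continuous_surjective {S : Set (Set ℕ)} {X : Type u} {Y : Type v}
    [TopologicalSpace X] [TopologicalSpace Y] (h : HasFiniteSelections S X) {f : X → Y}
    (hf : Continuous f) (hs : Function.Surjective f) : HasFiniteSelections S Y := fun _ hU =>
  let ⟨V, hV, hVS⟩ := h.exists_of_continuous hf hU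
  ⟨V, hV, hs.forall.2 hVS⟩

theorem IsHurewicz.isFilterMenger {F : Filter ℕ} (hfree : F ≤ cofinite) {X : Type u}
    [TopologicalSpace X] (h : IsHurewicz X) : IsFilterMenger F X :=
  isFilterMenger_iff.2 ((isHurewicz_iff.1 h).mono hfree)

theorem IsFilterMenger.isMenger {F : Filter ℕ} [F.NeBot] {X : Type u}
    [TopologicalSpace X] (h : IsFilterMenger F X) : IsMenger X :=
  isMenger_iff.2 ((isFilterMenger_iff.1 h).mono fun _ hA => F.nonempty_of_mem hA)

/-- Selections from increasing covers are given by functions. -/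
theorem HasFiniteSelections.exists_fun {S : Set (Set ℕ)} (hS : ∀ A ∈ S, ∀ B, A ⊆ B → B ∈ S)
    {X : Type u} [TopologicalSpace X] (h : HasFiniteSelections S X) {U : ℕ → ℕ → Set X}
    (hopen : ∀ n m, IsOpen (U n m)) (hmono : ∀ n, Monotone (U n))
    (hcover : ∀ n x, ∃ m, x ∈ U n m) : ∃ g : ℕ → ℕ, ∀ x, {n | x ∈ U n (g n)} ∈ S := by
  obtain ⟨V, hV, hVS⟩ := h (fun n => range (U n)) fun n =>
    ⟨by rintro _ ⟨m, rfl⟩; exact hopen n m, eq_univ_of_forall fun x =>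
      let ⟨m, hm⟩ := hcover n x
      ⟨_, mem_range_self m, hm⟩⟩
  have (n : ℕ) : ∃ g, ∀ W ∈ V n, W ⊆ U n g := by
    choose! i hi using (hV n).1
    obtain ⟨g, hg⟩ := ((hV n).2.image i).bddAbove
    exact ⟨g, fun W hW => (hi hW).symm.subset.trans (hmono n (hg (mem_image_of_mem i hW)))⟩
  choose g hg using this
  exact ⟨g, fun x => hS _ (hVS x) _ fun n ⟨W, hW, hx⟩ => hg n W hW hx⟩

/-- The Menger property yields selections that cover every point infinitely often. -/
theorem IsMenger.exists_fun_frequently {X : Type u} [TopologicalSpace X] (h : IsMenger X)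
    {U : ℕ → ℕ → Set X} (hopen : ∀ n m, IsOpen (U n m)) (hmono : ∀ n, Monotone (U n))
    (hcover : ∀ n x, ∃ m, x ∈ U n m) : ∃ g : ℕ → ℕ, ∀ x, ∃ᶠ n in atTop, x ∈ U n (g n) := by
  -- Menger is applied to every tail of the sequence; stage `n` then takes the maximum over the
  -- tails `N ≤ n`.
  have (N : ℕ) : ∃ g : ℕ → ℕ, ∀ x, ∃ n, x ∈ U (n + N) (g n) :=
    (isMenger_iff.1 h).exists_fun (U := fun n => U (n + N))
      (fun A hA B hAB => Set.Nonempty.mono hAB hA) (fun n => hopen _) (fun n => hmono _) (fun n => hcover _)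
  choose g hg using this
  refine ⟨fun n => (Finset.range (n + 1)).sup fun N => g N (n - N), fun x => ?_⟩
  rw [frequently_atTop]
  intro N
  obtain ⟨n, hn⟩ := hg N x
  refine ⟨n + N, by omega, hmono _ ?_ hn⟩
  have := Finset.le_sup (f := fun K => g K (n + N - K))
    (Finset.mem_range.2 (show N < n + N + 1 by omega))
  simpa using this

/-- In the product of a second countable and a hereditarily Lindelöf space, open covers have
countable subcovers. -/
theorem IsOpenCoverFamily.exists_countable_subset {X : Type u} {Y : Type v} [TopologicalSpace X]
    [TopologicalSpace Y] [SecondCountableTopology X] [HereditarilyLindelofSpace Y]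
    {U : Set (Set (X × Y))} (hU : IsOpenCoverFamily (X × Y) U) :
    ∃ U' ⊆ U, U'.Countable ∧ IsOpenCoverFamily (X × Y) U' := by
  let B := TopologicalSpace.countableBasis X
  have hBc : B.Countable := TopologicalSpace.countable_countableBasis X
  have hB : TopologicalSpace.IsTopologicalBasis B := TopologicalSpace.isBasis_countableBasis X
  -- The `W` with `s ×ˢ W` inside a member of `U` may have a non-closed union in `Y`, so Lindelöf
  -- alone would not give a countable subfamily with the same union.
  have key (s : Set X) : ∃ T ⊆ U, T.Countable ∧ ∀ W : Set Y, IsOpen W → ∀ u ∈ U, s ×ˢ W ⊆ u →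
      s ×ˢ W ⊆ ⋃₀ T := by
    let I := {p : Set Y × Set (X × Y) // IsOpen p.1 ∧ p.2 ∈ U ∧ s ×ˢ p.1 ⊆ p.2}
    obtain ⟨t, ht, htU⟩ := eq_open_union_countable (fun p : I => p.1.1) fun p => p.2.1
    refine ⟨(fun p : I => p.1.2) '' t, ?_, ht.image _, fun W hW u hu hsub => ?_⟩
    · rintro _ ⟨p, -, rfl⟩
      exact p.2.2.1
    · rintro ⟨x, y⟩ ⟨hx, hy⟩
      have : y ∈ ⋃ p : I, p.1.1 := mem_iUnion.2 ⟨⟨(W, u), hW, hu, hsub⟩, hy⟩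
      rw [← htU] at this
      obtain ⟨p, hp, hyp⟩ := mem_iUnion₂.1 this
      exact ⟨_, mem_image_of_mem _ hp, p.2.2.2 ⟨hx, hyp⟩⟩
  choose T hTU hTc hT using key
  refine ⟨⋃ s ∈ B, T s, iUnion₂_subset fun s _ => hTU s, hBc.biUnion fun s _ => hTc s,
    fun V hV => ?_, eq_univ_of_forall fun ⟨x, y⟩ => ?_⟩
  · obtain ⟨s, -, hV⟩ := mem_iUnion₂.1 hV
    exact hU.1 V (hTU s hV)
  · obtain ⟨u, hu, hxy⟩ : (x, y) ∈ ⋃₀ U := hU.2 ▸ mem_univ _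
    obtain ⟨O, W, hO, hW, hx, hy, hsub⟩ := isOpen_prod_iff.1 (hU.1 u hu) x y hxy
    obtain ⟨s, hs, hxs, hsO⟩ := hB.exists_subset_of_mem_open hx hO
    obtain ⟨V, hV, h⟩ := hT s W hW u hu ((prod_mono hsO subset_rfl).trans hsub)
      (show (x, y) ∈ s ×ˢ W from ⟨hxs, hy⟩)
    exact ⟨V, mem_iUnion₂.2 ⟨s, hs, hV⟩, h⟩

/-! ### Sets containing all sequences that are eventually equal to a given value -/

/-- Only `2 ^ n` sequences equal `v` from `n` on. Finitely many members of the cover therefore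
capture neighbourhoods of all of them, and one `m` serves every prefix. -/
theorem exists_open_finite_forall_const {Z : Set (ℕ → Bool)} {v : Bool}
    (hZ : ∀ z : ℕ → Bool, ∀ n, (∀ k, n ≤ k → z k = v) → z ∈ Z) {Y : Type u} [TopologicalSpace Y]
    {U : Set (Set (Z × Y))} (hU : IsOpenCoverFamily (Z × Y) U) (n : ℕ) (y : Y) :
    ∃ W : Set Y, IsOpen W ∧ y ∈ W ∧ ∃ m, ∃ V ⊆ U, V.Finite ∧
      ∀ z : Z, (∀ k, n ≤ k → k < m → z.1 k = v) → ∀ y' ∈ W, (z, y') ∈ ⋃₀ V := by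
  have key (q : Fin n → Bool) : ∃ u ∈ U, ∃ W : Set Y, IsOpen W ∧ y ∈ W ∧ ∃ m, ∀ z : Z,
      (∀ k (hk : k < n), z.1 k = q ⟨k, hk⟩) → (∀ k, n ≤ k → k < m → z.1 k = v) →
      ∀ y' ∈ W, (z, y') ∈ u := by
    let zq : Z := ⟨fun k => if hk : k < n then q ⟨k, hk⟩ else v,
      hZ _ n fun k hk => by simp [hk]⟩
    obtain ⟨u, hu, hyu⟩ : (zq, y) ∈ ⋃₀ U := hU.2 ▸ mem_univ _
    obtain ⟨O, W, hO, hW, hzO, hyW, hsub⟩ := isOpen_prod_iff.1 (hU.1 u hu) zq y hyu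
    obtain ⟨O', hO', rfl⟩ := isOpen_induced_iff.1 hO
    obtain ⟨I, t, ht, hIt⟩ := isOpen_pi_iff.1 hO' zq.1 hzO
    obtain ⟨M, hM⟩ := I.bddAbove
    refine ⟨u, hu, W, hW, hyW, M + 1, fun z h1 h2 y' hy' => hsub ⟨hIt fun k hk => ?_, hy'⟩⟩
    have : z.1 k = zq.1 k := by
      by_cases hkn : k < n
      · simp [zq, hkn, h1]
      · simpa [zq, hkn] using h2 k (not_lt.1 hkn) (Nat.lt_succ_of_le (hM hk))
    rw [this]
    exact (ht k hk).2
  choose u hu W hW hyW m hm using key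
  refine ⟨⋂ q, W q, isOpen_iInter_of_finite hW, mem_iInter.2 hyW, Finset.univ.sup m, range u,
    range_subset_iff.2 hu, finite_range u, fun z hz y' hy' => ?_⟩
  let q : Fin n → Bool := fun k => z.1 k
  exact ⟨u q, mem_range_self q, hm q z (fun _ _ => rfl) (fun k h1 h2 => hz k h1
    (h2.trans_le (Finset.le_sup (Finset.mem_univ q)))) y' (mem_iInter.1 hy' q)⟩

theorem isFilterMenger_prod_of_mk_lt {F : Filter ℕ} (hfree : F ≤ cofinite)
    {Z : Set (ℕ → Bool)} {v : Bool} (hZ : ∀ z : ℕ → Bool, ∀ n, (∀ k, n ≤ k → z k = v) → z ∈ Z)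
    (hbad : ∀ m : ℕ → ℕ, #{z : Z // {n | ∀ k, n ≤ k → k < m n → z.1 k = v} ∉ F} < boundingNumber)
    {Y : Type u} [TopologicalSpace Y] [HereditarilyLindelofSpace Y] (hY : IsFilterMenger F Y) :
    IsFilterMenger F (Z × Y) := by
  intro U' hU'
  choose U hUU' hUc hU using fun n => (hU' n).exists_countable_subset
  -- Covers of `Y` by sets `W` over which finitely many members of `U n` cover all `z` constant on a
  -- window `[n, m)`. The finite selection then bounds the windows by `M n`.
  have hT := hY (fun n => {W | IsOpen W ∧ ∃ m, ∃ V ⊆ U n, V.Finite ∧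
      ∀ z : Z, (∀ k, n ≤ k → k < m → z.1 k = v) → ∀ y' ∈ W, (z, y') ∈ ⋃₀ V}) fun n =>
    ⟨fun W hW => hW.1, eq_univ_of_forall fun y => by
      obtain ⟨W, hW, hyW, h⟩ := exists_open_finite_forall_const hZ (hU n) n y
      exact ⟨W, ⟨hW, h⟩, hyW⟩⟩
  obtain ⟨T, hT, hTF⟩ := hT
  choose! m V hVU hVf hV using fun n W (hW : W ∈ T n) => ((hT n).1 hW).2
  choose M hM using fun n => ((hT n).2.image (m n)).bddAbove
  -- Each slice `{z} × Y` has its own `F`-Menger selection; those of the fewer than `𝔟` exceptional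
  -- `z` are merged into one.
  choose V' hV' hV'F using fun z : Z => (isFilterMenger_iff.1 hY).exists_of_continuous
    (Continuous.prodMk_right z) hU
  obtain ⟨V'', hV'', hsub⟩ := exists_finite_eventually_subset (hbad M) hUc
    (V := fun z => V' z.1) fun z => hV' z.1
  refine ⟨fun n => (⋃ W ∈ T n, V n W) ∪ V'' n, fun n => ⟨?_, ?_⟩, fun ⟨z, y⟩ => ?_⟩
  · exact (union_subset (iUnion₂_subset (hVU n)) (hV'' n).1).trans (hUU' n)
  · exact ((hT n).2.biUnion (hVf n)).union (hV'' n).2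
  · by_cases hz : {n | ∀ k, n ≤ k → k < M n → z.1 k = v} ∈ F
    · filter_upwards [hz, hTF y] with n hn ⟨W, hW, hyW⟩
      obtain ⟨u, hu, hzu⟩ := hV n W hW z (fun k h1 h2 => hn k h1
        (h2.trans_le (hM n (mem_image_of_mem _ hW)))) y hyW
      exact ⟨u, Or.inl (mem_biUnion hW hu), hzu⟩
    · have := hsub ⟨z, hz⟩
      rw [← Nat.cofinite_eq_atTop] at this
      filter_upwards [hfree this, hV'F z y] with n hn ⟨u, hu, hzu⟩
      exact ⟨u, Or.inr (hn hu), hzu⟩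

theorem isMenger_of_mk_lt {Z : Set (ℕ → Bool)} {v : Bool}
    (hZ : ∀ z : ℕ → Bool, ∀ n, (∀ k, n ≤ k → z k = v) → z ∈ Z)
    (hbad : ∀ m : ℕ → ℕ,
      #{z : Z // ¬ ∃ n, ∀ k, n ≤ k → k < m n → z.1 k = v} < boundingNumber) :
    IsMenger Z := by
  -- The one-point factor makes the product lemmas applicable.
  suffices h : HasFiniteSelections {A | A.Nonempty} (Z × Unit) from
    isMenger_iff.2 (h.of_continuous_surjective continuous_fst Prod.fst_surjective)
  intro U' hU'
  choose U hUU' hUc hU using fun n => (hU' n).exists_countable_subset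
  choose W _ hW m V hVU hVf hV using fun n =>
    exists_open_finite_forall_const hZ (hU n) n ()
  have (z : Z) (n : ℕ) : ∃ u ∈ U n, (z, ()) ∈ u :=
    show (z, ()) ∈ ⋃₀ U n from (hU n).2 ▸ mem_univ _
  choose u hu hzu using this
  obtain ⟨V', hV', hsub⟩ := exists_finite_eventually_subset (hbad m) hUc
    (V := fun z n => {u z.1 n}) fun z n => ⟨singleton_subset_iff.2 (hu z.1 n), finite_singleton _⟩
  refine ⟨fun n => V n ∪ V' n, fun n => ⟨?_, (hVf n).union (hV' n).2⟩, fun ⟨z, y⟩ => ?_⟩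
  · exact (union_subset (hVU n) (hV' n).1).trans (hUU' n)
  · by_cases hz : ∃ n, ∀ k, n ≤ k → k < m n → z.1 k = v
    · obtain ⟨n, hn⟩ := hz
      obtain ⟨t, ht, hzt⟩ := hV n z hn () (hW n)
      exact ⟨n, t, Or.inl ht, hzt⟩
    · obtain ⟨n, hn⟩ := (hsub ⟨z, hz⟩).exists
      exact ⟨n, u z n, Or.inr (hn rfl), hzu z n⟩

/-- The points of `X` together with all sequences that are eventually equal to `v`. -/
def addEventually (v : Bool) (X : Set (ℕ → Bool)) : Set (ℕ → Bool) :=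
  X ∪ {z | ∃ n, ∀ k, n ≤ k → z k = v}

theorem mem_addEventually {v : Bool} {X : Set (ℕ → Bool)} (z : ℕ → Bool) (n : ℕ)
    (h : ∀ k, n ≤ k → z k = v) : z ∈ addEventually v X := Or.inr ⟨n, h⟩

/-- The added sequences are never exceptional, so exceptional points come from exceptional indices.
-/
theorem mk_addEventually_lt {ι : Type} {v : Bool} {x : ι → ℕ → Bool} {c : Cardinal.{0}}
    {P : (ℕ → Bool) → Prop} {Q : ι → Prop} (hP : ∀ z n, (∀ k, n ≤ k → z k = v) → P z)
    (hQ : ∀ i, Q i → P (x i)) (h : #{i // ¬ Q i} < c) :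
    #{z : addEventually v (range x) // ¬ P z} < c := by
  refine (Cardinal.mk_le_of_injective
    (f := fun z => (⟨z.1.1, ?_⟩ : (fun i => x i) '' {i | ¬ Q i})) ?_).trans_lt
    (Cardinal.mk_image_le.trans_lt h)
  · obtain ⟨⟨z, ⟨i, rfl⟩ | ⟨n, hn⟩⟩, hz⟩ := z
    · exact ⟨i, fun hi => hz (hQ i hi), rfl⟩
    · exact absurd (hP z n hn) hz
  · intro z w hzw
    exact Subtype.ext (Subtype.ext (by simpa using hzw))

theorem isOpen_setOf_apply_eq (k : ℕ) (v : Bool) : IsOpen {z : ℕ → Bool | z k = v} :=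
  (isOpen_discrete ({v} : Set Bool)).preimage (f := fun z : ℕ → Bool => z k) (continuous_apply k)

/-! ### Obstructions to Hurewicz and Menger -/

theorem not_isHurewicz_of_long_intervals {Z : Set (ℕ → Bool)}
    (hco : ∀ z ∈ Z, ∃ᶠ k in atTop, z k = false)
    (hlong : ∀ g : ℕ → ℕ, ∃ z ∈ Z, ∃ᶠ n in atTop, ∀ k, n ≤ k → k < g n → z k = true) :
    ¬ IsHurewicz Z := by
  intro h
  obtain ⟨g, hg⟩ := (isHurewicz_iff.1 h).exists_fun
    (U := fun n m => {z : Z | ∃ k, n ≤ k ∧ k < m ∧ z.1 k = false})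
    (fun A hA B hAB => mem_of_superset hA hAB)
    (fun n m => by
      have : IsOpen (⋃ k, ⋃ (_ : n ≤ k ∧ k < m), {z : ℕ → Bool | z k = false}) :=
        isOpen_iUnion fun k => isOpen_iUnion fun _ => isOpen_setOf_apply_eq k false
      convert this.preimage (continuous_subtype_val (p := (· ∈ Z))) using 1
      ext z
      simp [and_assoc])
    (fun n m m' hm z ⟨k, h1, h2, h3⟩ => ⟨k, h1, h2.trans_le hm, h3⟩)
    (fun n z => by
      obtain ⟨k, hk, hz⟩ := frequently_atTop.1 (hco z.1 z.2) n
      exact ⟨k + 1, k, hk, k.lt_succ_self, hz⟩)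
  obtain ⟨z, hz, hfreq⟩ := hlong g
  have : ∀ᶠ n in cofinite, ∃ k, n ≤ k ∧ k < g n ∧ z k = false := hg ⟨z, hz⟩
  rw [Nat.cofinite_eq_atTop] at this
  obtain ⟨n, hn, k, h1, h2, h3⟩ := (hfreq.and_eventually this).exists
  simp [hn k h1 h2] at h3

theorem not_isMenger_prod_of_long_alternations {A B : Set (ℕ → Bool)}
    (htrue : ∀ z ∈ A ∩ B, ∃ᶠ k in atTop, z k = true)
    (hfalse : ∀ z ∈ A ∩ B, ∃ᶠ k in atTop, z k = false)
    (hlong : ∀ g : ℕ → ℕ, ∃ z ∈ A ∩ B, ∀ᶠ n in atTop, ∀ i j k, n ≤ i → i < j → j < k → k < g n →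
      z i = true → z j = false → z k = false) :
    ¬ IsMenger (A × B) := by
  intro h
  let D : Set (A × B) := {p | p.1.1 = p.2.1}
  have hD : IsClosed D := isClosed_eq (by fun_prop) (by fun_prop)
  let G (n m : ℕ) : Set (ℕ → Bool) := {z | ∃ i j k, (n ≤ i ∧ i < j ∧ j < k ∧ k < m) ∧
    z i = true ∧ z j = false ∧ z k = true}
  have hG (n m : ℕ) : IsOpen (G n m) := by
    have : G n m = ⋃ i, ⋃ j, ⋃ k, ⋃ (_ : n ≤ i ∧ i < j ∧ j < k ∧ k < m),
        ({z | z i = true} ∩ ({z | z j = false} ∩ {z | z k = true})) := by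
      ext z
      simp only [G, mem_iUnion, mem_inter_iff, mem_ofPred_eq, exists_prop]
    rw [this]
    exact isOpen_iUnion fun i => isOpen_iUnion fun j => isOpen_iUnion fun k => isOpen_iUnion
      fun _ => (isOpen_setOf_apply_eq i true).inter
        ((isOpen_setOf_apply_eq j false).inter (isOpen_setOf_apply_eq k true))
  -- Covering infinitely often is essential, as `hlong` excludes the pattern only for large `n`.
  obtain ⟨g, hg⟩ := h.exists_fun_frequently (U := fun n m => Dᶜ ∪ {p : A × B | p.1.1 ∈ G n m})
    (fun n m => hD.isOpen_compl.union ((hG n m).preimage (by fun_prop)))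
    (fun n m m' hm => union_subset_union_right _ fun p ⟨i, j, k, h1, h2⟩ =>
      ⟨i, j, k, ⟨h1.1, h1.2.1, h1.2.2.1, h1.2.2.2.trans_le hm⟩, h2⟩)
    (fun n p => by
      by_cases hp : p ∈ D
      · have hpAB : p.1.1 ∈ A ∩ B := ⟨p.1.2, by rw [show p.1.1 = p.2.1 from hp]; exact p.2.2⟩
        obtain ⟨i, hi, hzi⟩ := frequently_atTop.1 (htrue _ hpAB) n
        obtain ⟨j, hj, hzj⟩ := frequently_atTop.1 (hfalse _ hpAB) (i + 1)
        obtain ⟨k, hk, hzk⟩ := frequently_atTop.1 (htrue _ hpAB) (j + 1)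
        exact ⟨k + 1, Or.inr ⟨i, j, k, ⟨hi, hj, hk, k.lt_succ_self⟩, hzi, hzj, hzk⟩⟩
      · exact ⟨0, Or.inl hp⟩)
  obtain ⟨z, hz, hev⟩ := hlong g
  obtain ⟨n, hn, hn'⟩ := ((hg (⟨z, hz.1⟩, ⟨z, hz.2⟩)).and_eventually hev).exists
  rcases hn with hn | ⟨i, j, k, ⟨h1, h2, h3, h4⟩, h5, h6, h7⟩
  · exact hn rfl
  · have := hn' i j k h1 h2 h3 h4 h5 h6
    exact Bool.false_ne_true (this.symm.trans h7)

/-- The construction in the Cantor space. -/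
theorem exists_cantor_sets (hbd : boundingNumber = dominatingNumber)
    {F : Filter ℕ} [F.NeBot] (hfree : F ≤ cofinite)
    (hF : ¬ IsMeagre (filterAsCantorSubset F)) :
    ∃ A B : Set (ℕ → Bool),
      (∀ (Y : Type u) [TopologicalSpace Y] [HereditarilyLindelofSpace Y],
        IsFilterMenger F Y → IsFilterMenger F (A × Y)) ∧
      ¬ IsHurewicz A ∧ IsMenger B ∧ ¬ IsMenger (A × B) := by
  obtain ⟨ι, b, hb, hlt, hsmall, hdom⟩ := exists_scale hbd
  choose x hgaps hlong halt using fun i => exists_long_gaps_long_intervals hfree hF (hb i) (hlt i)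
  have htrue (i : ι) : ∃ᶠ k in atTop, x i k = true :=
    (hlong i).mono fun n hn => hn n le_rfl (hlt i n)
  have hfalse (i : ι) : ∃ᶠ k in atTop, x i k = false := by
    -- Windows of length one: `x i` vanishes on a set in `F`.
    have h := hgaps i (fun n => n + 1) (Eventually.of_forall (hlt i))
    have h' : ∃ᶠ k in F, x i k = false := Eventually.frequently <|
      mem_of_superset h fun n hn => hn n le_rfl n.lt_succ_self
    exact h'.filter_mono (Nat.cofinite_eq_atTop ▸ hfree)
  have hAB : ∀ z ∈ addEventually false (range x) ∩ addEventually true (range x),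
      ∃ i, x i = z := by
    rintro z ⟨h | ⟨n, hn⟩, h' | ⟨n', hn'⟩⟩
    · exact h
    · exact h
    · exact h'
    · have := hn (max n n') (le_max_left _ _)
      rw [hn' (max n n') (le_max_right _ _)] at this
      cases this
  refine ⟨addEventually false (range x), addEventually true (range x), fun Y _ _ hY => ?_, ?_, ?_,
    ?_⟩
  · refine isFilterMenger_prod_of_mk_lt hfree mem_addEventually (fun m => ?_) hY
    refine mk_addEventually_lt (P := fun z => {n | ∀ k, n ≤ k → k < m n → z k = false} ∈ F)
      (fun z n hz => ?_) (fun i hi => hgaps i m hi) (hsmall m)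
    have : ∀ᶠ k in F, n ≤ k := hfree (Nat.cofinite_eq_atTop ▸ eventually_ge_atTop n)
    exact this.mono fun l hl k hk _ => hz k (hl.trans hk)
  · refine not_isHurewicz_of_long_intervals ?_ fun g => ?_
    · rintro z (⟨i, rfl⟩ | ⟨n, hn⟩)
      · exact hfalse i
      · exact (eventually_atTop.2 ⟨n, hn⟩).frequently
    · obtain ⟨i, hi⟩ := hdom g
      exact ⟨x i, Or.inl (mem_range_self i), ((hlong i).and_eventually hi).mono
        fun n hn k h1 h2 => hn.1 k h1 (h2.trans_le hn.2)⟩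
  · refine isMenger_of_mk_lt mem_addEventually fun m => ?_
    refine mk_addEventually_lt (P := fun z => ∃ n, ∀ k, n ≤ k → k < m n → z k = true)
      (fun z n hz => ⟨n, fun k hk _ => hz k hk⟩) (fun i hi => ?_) (hsmall m)
    obtain ⟨n, hn, hmn⟩ := ((hlong i).and_eventually hi).exists
    exact ⟨n, fun k h1 h2 => hn k h1 (h2.trans_le hmn)⟩
  · refine not_isMenger_prod_of_long_alternations ?_ ?_ fun g => ?_
    · intro z hz
      obtain ⟨i, rfl⟩ := hAB z hz
      exact htrue i
    · intro z hz
      obtain ⟨i, rfl⟩ := hAB z hz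
      exact hfalse i
    · obtain ⟨i, hi⟩ := hdom g
      exact ⟨x i, ⟨Or.inl (mem_range_self i), Or.inl (mem_range_self i)⟩, hi.mono
        fun n hn i' j k h1 h2 h3 h4 => halt i n i' j k h1 h2 h3 (h4.trans_le hn)⟩

/-! ### Transfer to sets of reals -/

theorem exists_homeomorph_set_real (A : Set (ℕ → Bool)) : ∃ X : Set ℝ, Nonempty (A ≃ₜ X) := by
  have h : Topology.IsEmbedding (fun z => (cantorSetHomeomorphNatToBool.symm z : ℝ)) :=
    Topology.IsEmbedding.subtypeVal.comp cantorSetHomeomorphNatToBool.symm.isEmbedding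
  exact ⟨_, ⟨h.homeomorphImage A⟩⟩

theorem isFilterMenger_of_finite (F : Filter ℕ) (X : Type u) [TopologicalSpace X] [Finite X] :
    IsFilterMenger F X := by
  intro U hU
  have (n : ℕ) (x : X) : ∃ u ∈ U n, x ∈ u :=
    show x ∈ ⋃₀ U n from (hU n).2 ▸ mem_univ _
  choose u hu hxu using this
  exact ⟨fun n => range (u n), fun n => ⟨range_subset_iff.2 (hu n), finite_range _⟩, fun x =>
    univ_mem' fun n => ⟨u n x, mem_range_self x, hxu n x⟩⟩

theorem mainTheorem6 (hbd : boundingNumber = dominatingNumber)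
    (F : Filter ℕ) (hne : F.NeBot) (hfree : F ≤ Filter.cofinite)
    (hF : ¬ IsMeagre (filterAsCantorSubset F)) :
    (∃ X : Set ℝ,
      IsProductivelyHL.{u} (fun Z _ => IsFilterMenger F Z) X ∧
      ¬ IsHurewicz X ∧
      ¬ IsProductivelyHL.{v} (fun Z _ => IsMenger Z) X) ∧
    ((∀ (Z : Type u) [TopologicalSpace Z], IsHurewicz Z → IsFilterMenger F Z) ∧
      (∀ (Z : Type u) [TopologicalSpace Z], IsFilterMenger F Z → IsMenger Z) ∧
      (∃ Z : Set ℝ, IsFilterMenger F Z ∧ ¬ IsHurewicz Z) ∧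
      (∃ Z : Set ℝ, IsMenger Z ∧ ¬ IsFilterMenger F Z)) := by
  obtain ⟨A, B, hA, hAH, hB, hAB⟩ := exists_cantor_sets.{u} hbd hfree hF
  obtain ⟨X, ⟨e⟩⟩ := exists_homeomorph_set_real A
  obtain ⟨Z, ⟨e'⟩⟩ := exists_homeomorph_set_real B
  have hX : IsProductivelyHL.{u} (fun Z _ => IsFilterMenger F Z) X := fun Y _ _ hY =>
    isFilterMenger_iff.2 ((isFilterMenger_iff.1 (hA Y hY)).of_continuous_surjective
      (e.prodCongr (Homeomorph.refl Y)).continuous (e.prodCongr (Homeomorph.refl Y)).surjective)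
  have hXH : ¬ IsHurewicz X := fun h => hAH <| isHurewicz_iff.2 <|
    (isHurewicz_iff.1 h).of_continuous_surjective e.symm.continuous e.symm.surjective
  have hX' : IsFilterMenger F X := isFilterMenger_iff.2 <|
    (isFilterMenger_iff.1 (hX PUnit (isFilterMenger_of_finite F PUnit))).of_continuous_surjective
      continuous_fst Prod.fst_surjective
  refine ⟨⟨X, hX, hXH, fun h => hAB ?_⟩, fun Y _ h => h.isFilterMenger hfree,
    fun Y _ h => h.isMenger, ⟨X, hX', hXH⟩, Z, ?_, fun h => hAB ?_⟩
  -- Lifting `B` to the required universe; second countability makes it hereditarily Lindelöf.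
  · have : SecondCountableTopology (ULift.{v} B) := Homeomorph.ulift.secondCountableTopology
    let f : X × ULift.{v} B ≃ₜ A × B := e.symm.prodCongr Homeomorph.ulift
    have hB' : IsMenger (ULift.{v} B) := isMenger_iff.2 <|
      (isMenger_iff.1 hB).of_continuous_surjective
        Homeomorph.ulift.symm.continuous Homeomorph.ulift.symm.surjective
    exact isMenger_iff.2 <|
      (isMenger_iff.1 (h (ULift B) hB')).of_continuous_surjective f.continuous f.surjective
  · exact isMenger_iff.2 <|
      (isMenger_iff.1 hB).of_continuous_surjective e'.continuous e'.surjective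
  · have : SecondCountableTopology (ULift.{u} B) := Homeomorph.ulift.secondCountableTopology
    let f : Z ≃ₜ ULift.{u} B := e'.symm.trans Homeomorph.ulift.symm
    let g : A × ULift.{u} B ≃ₜ A × B := (Homeomorph.refl A).prodCongr Homeomorph.ulift
    have hB' : IsFilterMenger F (ULift.{u} B) := isFilterMenger_iff.2 <|
      (isFilterMenger_iff.1 h).of_continuous_surjective f.continuous f.surjective
    exact isMenger_iff.2 <| (isMenger_iff.1 (hA _ hB').isMenger).of_continuous_surjective
      g.continuous g.surjective
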